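/- Let $\mathcal H$ be a real Hilbert space (for instance a real reproducing kernel Hilbert space) and let $\phi:\mathbb R^d\to\mathcal H$ be a (strongly measurable) feature map of a kernel $k$, that is, $\langle\phi(x),\phi(x')\rangle=k(x,x')$, with $\|\phi(x)\|\le B$ for all $x$. Fix $\delta,\lambda_F>0$ and let $\ell:\mathbb R\to\mathbb R$ be $\alpha$-Lipschitz. Let $\mathcal D$ be a joint law of a triplet $t=(x_h,x_i,x_j)\in(\mathbb R^d)^3$ and a label $y\in\{\pm1\}$. For a bounded linear map $L:\mathcal H\to\mathcal H$ put $$\Delta_L(t)=\|L\phi(x_h)-L\phi(x_i)\|^2-\|L\phi(x_h)-L\phi(x_j)\|^2,\qquad R(L)=\mathbb E_{(t,y)\sim\mathcal D}\,\ell\big(y\,\Delta_L(t)\big).$$ For a sample $\mathcal S$ of $|\mathcal S|\ge 1$ i.i.d. labelled triplets drawn from $\mathcal D$, put $$\widehat R_{\mathcal S}(L)=\frac1{|\mathcal S|}\sum_{(t,y)\in\mathcal S}\ell\big(y\,\Delta_L(t)\big),$$ and let $P$ be the orthogonal projection onto the span of the features $\phi(x)$ of the $3|\mathcal S|$ objects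 occurring in the sample. Let $\|T\|_{S_2}=\big(\sum_i s_i(T)^2\big)^{1/2}$ denote the Schatten 2-norm of a compact operator $T$ with singular values $s_i(T)$ (and $\|T\|_{S_2}=\infty$ if $T$ is not compact). Let $L^*$ minimize $R(L)$ over all bounded $L$ with $\|L^\dagger L\|_{S_2}\le\lambda_F$. Then, with probability at least $1-\delta$ over the sample, every $\widehat L_0$ that minimizes $\widehat R_{\mathcal S}(L)$ over all bounded $L$ with $\|P^\dagger L^\dagger L P\|_{S_2}\le\lambda_F$ and that satisfies $\widehat L_0P=\widehat L_0$ fulfils $$R(\widehat L_0)-R(L^*)\le 4\alpha B^2\lambda_F\sqrt{\frac{6}{|\mathcal S|}}+12\alpha B^2\lambda_F\sqrt{\frac{2\ln(2/\delta)}{|\mathcal S|}}.$$ -/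

import Mathlib

open MeasureTheory
open scoped NNReal ENNReal InnerProductSpace InnerProduct

noncomputable section

namespace KernelMetric

/-- Objects are points of `ℝ^d`. -/
abbrev Point (d : ℕ) : Type := EuclideanSpace ℝ (Fin d)

/-- A triplet `(x_h, x_i, x_j)` of objects. -/
abbrev Triplet (d : ℕ) : Type := Point d × Point d × Point d

/-- A labelled triplet `(t, y_t)`; the label is a real number, which the law of the data
forces to be `1` or `-1`. -/
abbrev LabelledTriplet (d : ℕ) : Type := Triplet d × ℝ

variable {H : Type*} [NormedAddCommGroup H] [InnerProductSpace ℝ H]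

/-- `φ` is a feature map of the kernel `k` with values in `H`: `⟪φ x, φ x'⟫ = k x x'`. -/
def IsFeatureMap {d : ℕ} (k : Point d → Point d → ℝ) (φ : Point d → H) : Prop :=
  ∀ x x' : Point d, ⟪φ x, φ x'⟫_ℝ = k x x'

/-- The Schatten `p`-norm `(∑ i, s_i(T) ^ p) ^ (1 / p)`, with values in `[0, ∞]`.
The nonzero singular values of a compact operator `T` are the numbers `√μ`, where `μ` runs over
the positive eigenvalues of `T† T`, each repeated as often as the (finite) dimension of its
eigenspace. A value `μ` that is not an eigenvalue has a zero eigenspace and contributes `0`.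
Operators that are not compact have norm `∞`. -/
def schattenNorm [CompleteSpace H] (p : ℝ) (T : H →L[ℝ] H) : ℝ≥0∞ :=
  open Classical in
  if IsCompactOperator T then
    (∑' μ : Set.Ioi (0 : ℝ),
      (Module.finrank ℝ
        (Module.End.eigenspace ((T† ∘L T : H →L[ℝ] H) : H →ₗ[ℝ] H) (μ : ℝ)) : ℝ≥0∞)
        * ENNReal.ofReal (Real.sqrt (μ : ℝ)) ^ p) ^ (1 / p)
  else ⊤

/-- The difference of squared distances
`‖L φ(x_h) - L φ(x_i)‖² - ‖L φ(x_h) - L φ(x_j)‖²` of a triplet `t = (x_h, x_i, x_j)`. -/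
def distDiff {d : ℕ} (φ : Point d → H) (L : H →L[ℝ] H) (t : Triplet d) : ℝ :=
  ‖L (φ t.1) - L (φ t.2.1)‖ ^ 2 - ‖L (φ t.1) - L (φ t.2.2)‖ ^ 2

/-- The true risk `R(L)`, when a labelled triplet has law `μ`. -/
def trueRisk {d : ℕ} (φ : Point d → H) (ℓ : ℝ → ℝ) (μ : Measure (LabelledTriplet d))
    (L : H →L[ℝ] H) : ℝ :=
  ∫ z, ℓ (z.2 * distDiff φ L z.1) ∂μ

/-- The empirical risk of `L` on the sample `S = (S 1, …, S m)` of labelled triplets. -/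
def empiricalRisk {d m : ℕ} (φ : Point d → H) (ℓ : ℝ → ℝ) (S : Fin m → LabelledTriplet d)
    (L : H →L[ℝ] H) : ℝ :=
  (1 / (m : ℝ)) * ∑ s : Fin m, ℓ ((S s).2 * distDiff φ L (S s).1)

/-- The span of the features of the `3 m` objects that occur in the sample. -/
def sampleSpan {d m : ℕ} (φ : Point d → H) (S : Fin m → LabelledTriplet d) : Submodule ℝ H :=
  Submodule.span ℝ
    (Set.range (fun s => φ (S s).1.1) ∪ Set.range (fun s => φ (S s).1.2.1)
      ∪ Set.range (fun s => φ (S s).1.2.2))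

instance {d m : ℕ} (φ : Point d → H) (S : Fin m → LabelledTriplet d) :
    FiniteDimensional ℝ (sampleSpan φ S) :=
  FiniteDimensional.span_of_finite ℝ
    (((Set.finite_range _).union (Set.finite_range _)).union (Set.finite_range _))

/-- The orthogonal projection of `H` onto the span of the sample features. -/
def sampleProj {d m : ℕ} (φ : Point d → H) (S : Fin m → LabelledTriplet d) : H →L[ℝ] H :=
  (sampleSpan φ S).starProjection

variable [CompleteSpace H]

/-- `L*` minimizes the true risk among all bounded `L` with `‖L† L‖_{S_2} ≤ lam`. -/
def IsTrueRiskMinimizer {d : ℕ} (φ : Point d → H) (ℓ : ℝ → ℝ) (μ : Measure (LabelledTriplet d))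
    (lam : ℝ) (Lstar : H →L[ℝ] H) : Prop :=
  Lstar ∈ {L : H →L[ℝ] H | schattenNorm 2 (L† ∘L L) ≤ ENNReal.ofReal lam} ∧
  IsMinOn (trueRisk φ ℓ μ) {L : H →L[ℝ] H | schattenNorm 2 (L† ∘L L) ≤ ENNReal.ofReal lam} Lstar

/-- The operators `L` with `‖P† L† L P‖_{S_2} ≤ lam`, where `P` is the orthogonal projection onto
the span of the sample features. -/
def spanFeasible {d m : ℕ} (φ : Point d → H) (S : Fin m → LabelledTriplet d) (lam : ℝ) :
    Set (H →L[ℝ] H) :=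
  {L | schattenNorm 2 ((sampleProj φ S)† ∘L L† ∘L L ∘L sampleProj φ S) ≤ ENNReal.ofReal lam}

/-- `L₀` is a span-restricted empirical risk minimizer: it minimizes the empirical risk among all
bounded `L` with `‖P† L† L P‖_{S_2} ≤ lam`, and it lives on the span of the sample features,
`L₀ P = L₀`. -/
def IsSpanRestrictedERM {d m : ℕ} (φ : Point d → H) (ℓ : ℝ → ℝ) (S : Fin m → LabelledTriplet d)
    (lam : ℝ) (L₀ : H →L[ℝ] H) : Prop :=
  L₀ ∈ spanFeasible φ S lam ∧
  IsMinOn (empiricalRisk φ ℓ S) (spanFeasible φ S lam) L₀ ∧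
  L₀ ∘L sampleProj φ S = L₀

end KernelMetric

end

/-! ### Suprema of uniformly bounded families -/

/-! The loss is a Lipschitz function of a linear functional. With `u = φ x_h - φ x_i` and `v = φ x_h
- φ x_j`, the quantity `y * distDiff φ L t` is the Hilbert–Schmidt inner product of `L† L` with `y
(u ⊗ u - v ⊗ v)`, a vector of norm at most `K = 2√6 B²` (`norm_tripletFeature_le`). The Schatten
2-norm is the Hilbert–Schmidt norm (`schattenNorm_two_eq`), so the constraint on `L† L` places it in
the ball of radius `lamF` of a Hilbert space.

Both operators lie in that ball: `L*` by assumption, and `L₀` because `L₀ P = L₀` removes the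
projection from its constraint. Conjugation by `P` does not increase the norm
(`schattenNorm_two_conj_le`), so `L*` also competes in the empirical problem, and the empirical risk
of `L₀` is at most that of `L*`. The excess risk is therefore at most the deviation of true from
empirical risk at `L₀` minus the same deviation at `L*`.

This difference is bounded uniformly over the ball in `exists_uniform_risk_bound`. Symmetrization
and contraction bound the mean of the supremum by `2 α lamF K / √m`, and McDiarmid's inequality
bounds the fluctuation. All functionals are handled on one event, so the bound covers every
empirical minimizer. -/

theorem bddAbove_range_of_abs_le {ι : Type*} {f : ι → ℝ} {C : ℝ} (h : ∀ i, |f i| ≤ C) :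
    BddAbove (Set.range f) :=
  ⟨C, by rintro _ ⟨i, rfl⟩; exact (le_abs_self _).trans (h i)⟩

theorem abs_iSup_le_of_abs_le {ι : Type*} [Nonempty ι] {f : ι → ℝ} {C : ℝ}
    (h : ∀ i, |f i| ≤ C) : |⨆ i, f i| ≤ C := by
  obtain ⟨i⟩ := ‹Nonempty ι›
  have : Nonempty ι := ⟨i⟩
  refine abs_le.2 ⟨?_, ciSup_le fun j => (le_abs_self _).trans (h j)⟩
  exact (abs_le.1 (h i)).1.trans (le_ciSup (bddAbove_range_of_abs_le h) i)

theorem integrable_of_abs_le {Ω : Type*} [MeasurableSpace Ω] {μ : Measure Ω} [IsFiniteMeasure μ]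
    {f : Ω → ℝ} (hf : Measurable f) {C : ℝ} (h : ∀ x, |f x| ≤ C) : Integrable f μ :=
  Integrable.of_bound hf.aestronglyMeasurable C (Filter.Eventually.of_forall h)

theorem abs_integral_le_of_abs_le {Ω : Type*} [MeasurableSpace Ω] {μ : Measure Ω}
    [IsProbabilityMeasure μ] {f : Ω → ℝ} {C : ℝ} (h : ∀ x, |f x| ≤ C) :
    |∫ x, f x ∂μ| ≤ C := by
  have := norm_integral_le_of_norm_le_const (μ := μ) (f := f) (Filter.Eventually.of_forall h)
  simpa using this

/-! ### Integration over a finite power of a probability space -/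

theorem measurable_finCons {Z : Type*} [MeasurableSpace Z] {m : ℕ} :
    Measurable (fun p : Z × (Fin m → Z) => (Fin.cons p.1 p.2 : Fin (m + 1) → Z)) := by
  refine measurable_pi_iff.2 fun i => ?_
  refine Fin.cases ?_ (fun j => ?_) i
  · simpa using measurable_fst
  · simp only [Fin.cons_succ]
    fun_prop

theorem integral_pi_succ {Z : Type*} [MeasurableSpace Z] (μ : Measure Z) [IsProbabilityMeasure μ]
    {m : ℕ} (f : (Fin (m + 1) → Z) → ℝ) :
    ∫ S, f S ∂Measure.pi (fun _ => μ) =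
      ∫ p : Z × (Fin m → Z), f (Fin.cons p.1 p.2) ∂(μ.prod (Measure.pi fun _ => μ)) := by
  rw [← ((measurePreserving_piFinSuccAbove (fun _ => μ) 0).symm).integral_comp']
  simp only [MeasurableEquiv.piFinSuccAbove_symm_apply, Fin.insertNthEquiv, Fin.insertNth_zero,
    Equiv.coe_fn_mk]
  rfl

/-! ### Expected suprema of empirical processes -/

/-- Contraction principle for one random sign. For indices `i`, `j` on the left, `ℓ (t i) - ℓ (t j)
≤ α |t i - t j|`. The sign of `t i - t j` decides which of the two indices is used in which supremum
on the right. -/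
theorem iSup_add_iSup_le_of_lipschitz {ι : Type*} [Nonempty ι] {ℓ : ℝ → ℝ} {α : ℝ≥0}
    (hℓ : LipschitzWith α ℓ) {g t : ι → ℝ} {C T : ℝ} (hg : ∀ i, |g i| ≤ C) (ht : ∀ i, |t i| ≤ T) :
    (⨆ i, (g i + 2 * ℓ (t i))) + (⨆ i, (g i - 2 * ℓ (t i))) ≤
      (⨆ i, (g i + 2 * α * t i)) + (⨆ i, (g i - 2 * α * t i)) := by
  have hα : (0 : ℝ) ≤ α := α.2
  have hαt : ∀ i, |2 * α * t i| ≤ 2 * α * T := fun i => by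
    rw [abs_mul, abs_of_nonneg (by positivity : (0 : ℝ) ≤ 2 * α)]
    exact mul_le_mul_of_nonneg_left (ht i) (by positivity)
  have h1 : BddAbove (Set.range fun i => g i + 2 * α * t i) :=
    bddAbove_range_of_abs_le fun i => (abs_add_le _ _).trans (add_le_add (hg i) (hαt i))
  have h2 : BddAbove (Set.range fun i => g i - 2 * α * t i) :=
    bddAbove_range_of_abs_le fun i => (abs_sub _ _).trans (add_le_add (hg i) (hαt i))
  have key : ∀ i j, (g i + 2 * ℓ (t i)) + (g j - 2 * ℓ (t j)) ≤
      (⨆ i, (g i + 2 * α * t i)) + (⨆ i, (g i - 2 * α * t i)) := fun i j => by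
    have hd : ℓ (t i) - ℓ (t j) ≤ α * |t i - t j| := by
      have := hℓ.dist_le_mul (t i) (t j)
      rw [Real.dist_eq, Real.dist_eq] at this
      exact (le_abs_self _).trans this
    have a1 := le_ciSup h1 i
    have a2 := le_ciSup h1 j
    have b1 := le_ciSup h2 i
    have b2 := le_ciSup h2 j
    rcases abs_cases (t i - t j) with ⟨h, -⟩ | ⟨h, -⟩ <;> rw [h] at hd <;> nlinarith
  have h3 : ∀ j, (⨆ i, (g i + 2 * ℓ (t i))) ≤
      (⨆ i, (g i + 2 * α * t i)) + (⨆ i, (g i - 2 * α * t i)) - (g j - 2 * ℓ (t j)) :=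
    fun j => ciSup_le fun i => by linarith [key i j]
  have h4 : (⨆ j, (g j - 2 * ℓ (t j))) ≤
      (⨆ i, (g i + 2 * α * t i)) + (⨆ i, (g i - 2 * α * t i)) - ⨆ i, (g i + 2 * ℓ (t i)) :=
    ciSup_le fun j => by linarith [h3 j]
  linarith

/-- Symmetrization and contraction for a single observation. -/
theorem integral_iSup_le_integral_symmetrized {Z ι : Type*} [MeasurableSpace Z] (μ : Measure Z)
    [IsProbabilityMeasure μ] [Countable ι] [Nonempty ι] {ℓ : ℝ → ℝ} {α : ℝ≥0}
    (hℓ : LipschitzWith α ℓ) {t : ι → Z → ℝ} (htm : ∀ i, Measurable (t i)) {T : ℝ}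
    (ht : ∀ i z, |t i z| ≤ T) {g : ι → ℝ} {C : ℝ} (hg : ∀ i, |g i| ≤ C) :
    ∫ z, (⨆ i, (g i + ((∫ z', ℓ (t i z') ∂μ) - ℓ (t i z)))) ∂μ ≤
      ∫ z, ((⨆ i, (g i + 2 * α * t i z)) + (⨆ i, (g i - 2 * α * t i z))) / 2 ∂μ := by
  have hα : (0 : ℝ) ≤ α := α.2
  have hlm : Measurable ℓ := hℓ.continuous.measurable
  obtain ⟨D, hD⟩ : ∃ D, ∀ i z, |ℓ (t i z)| ≤ D := by
    refine ⟨|ℓ 0| + α * T, fun i z => ?_⟩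
    have h1 := hℓ.dist_le_mul (t i z) 0
    rw [Real.dist_eq, Real.dist_eq, sub_zero] at h1
    have h2 := abs_sub_abs_le_abs_sub (ℓ (t i z)) (ℓ 0)
    have h3 := mul_le_mul_of_nonneg_left (ht i z) hα
    linarith
  have hlt : ∀ i, Measurable fun z => ℓ (t i z) := fun i => hlm.comp (htm i)
  have hE : ∀ i, |∫ z', ℓ (t i z') ∂μ| ≤ D := fun i => abs_integral_le_of_abs_le (hD i)
  have hint : ∀ c : ι → Z → ℝ, (∀ i, Measurable (c i)) → (∃ M, ∀ i z, |c i z| ≤ M) →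
      Integrable (fun z => ⨆ i, c i z) μ := fun c hc ⟨M, hM⟩ =>
    integrable_of_abs_le (Measurable.iSup hc) fun z => abs_iSup_le_of_abs_le fun i => hM i z
  have hb1 : ∀ i z, |g i + 2 * ℓ (t i z)| ≤ C + 2 * D := fun i z => by
    have := abs_add_le (g i) (2 * ℓ (t i z))
    rw [abs_mul, abs_two] at this
    linarith [hg i, hD i z]
  have hb2 : ∀ i z, |g i - 2 * ℓ (t i z)| ≤ C + 2 * D := fun i z => by
    have := abs_sub (g i) (2 * ℓ (t i z))
    rw [abs_mul, abs_two] at this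
    linarith [hg i, hD i z]
  have hαt : ∀ i z, |2 * α * t i z| ≤ 2 * α * T := fun i z => by
    rw [abs_mul, abs_of_nonneg (by positivity : (0 : ℝ) ≤ 2 * α)]
    exact mul_le_mul_of_nonneg_left (ht i z) (by positivity)
  have i1 := hint (fun i z => g i + 2 * ℓ (t i z))
    (fun i => ((hlt i).const_mul 2).const_add _) ⟨_, hb1⟩
  have i2 := hint (fun i z => g i - 2 * ℓ (t i z))
    (fun i => ((hlt i).const_mul 2).const_sub _) ⟨_, hb2⟩
  have i3 := hint (fun i z => g i + 2 * α * t i z)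
    (fun i => ((htm i).const_mul _).const_add _)
    ⟨C + 2 * α * T, fun i z => (abs_add_le _ _).trans (add_le_add (hg i) (hαt i z))⟩
  have i4 := hint (fun i z => g i - 2 * α * t i z)
    (fun i => ((htm i).const_mul _).const_sub _)
    ⟨C + 2 * α * T, fun i z => (abs_sub _ _).trans (add_le_add (hg i) (hαt i z))⟩
  have i0 := hint (fun i z => g i + ((∫ z', ℓ (t i z') ∂μ) - ℓ (t i z)))
    (fun i => ((hlt i).const_sub _).const_add _)
    ⟨C + 2 * D, fun i z => by
      have := abs_add_le (g i) ((∫ z', ℓ (t i z') ∂μ) - ℓ (t i z))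
      have := abs_sub (∫ z', ℓ (t i z') ∂μ) (ℓ (t i z))
      linarith [hg i, hD i z, hE i]⟩
  have hsupE : (⨆ i, (g i + 2 * ∫ z', ℓ (t i z') ∂μ)) ≤ ∫ z, (⨆ i, (g i + 2 * ℓ (t i z))) ∂μ := by
    refine ciSup_le fun i => ?_
    have hi : Integrable (fun z => g i + 2 * ℓ (t i z)) μ :=
      integrable_of_abs_le (((hlt i).const_mul 2).const_add _) (hb1 i)
    have : g i + 2 * ∫ z', ℓ (t i z') ∂μ = ∫ z, (g i + 2 * ℓ (t i z)) ∂μ := by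
      rw [integral_add (integrable_const _)
        ((integrable_of_abs_le (hlt i) (hD i)).const_mul 2), integral_const_mul]
      simp
    rw [this]
    exact integral_mono hi i1 fun z =>
      le_ciSup (f := fun i => g i + 2 * ℓ (t i z)) (bddAbove_range_of_abs_le fun i => hb1 i z) i
  have hbE : BddAbove (Set.range fun i => g i + 2 * ∫ z', ℓ (t i z') ∂μ) :=
    bddAbove_range_of_abs_le (C := C + 2 * D) fun i => by
      have := abs_add_le (g i) (2 * ∫ z', ℓ (t i z') ∂μ)
      rw [abs_mul, abs_two] at this
      linarith [hg i, hE i]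
  -- Splitting `g` into two halves bounds the supremum by half the sum of the suprema of `g + 2 E ℓ`
  -- and `g - 2 ℓ`; this is the source of the factor 2. By `hsupE` (Jensen) the mean leaves the
  -- first supremum, and after integration both suprema may be taken at the same `z`, without a
  -- ghost sample. Contraction then removes `ℓ`.
  calc ∫ z, (⨆ i, (g i + ((∫ z', ℓ (t i z') ∂μ) - ℓ (t i z)))) ∂μ
      ≤ ∫ z, ((∫ z, (⨆ i, (g i + 2 * ℓ (t i z))) ∂μ) + (⨆ i, (g i - 2 * ℓ (t i z)))) / 2 ∂μ := by
        refine integral_mono i0 (((integrable_const _).add i2).div_const 2) fun z => ?_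
        refine ciSup_le fun i => ?_
        have h1 := (le_ciSup hbE i).trans hsupE
        have h2 := le_ciSup (f := fun i => g i - 2 * ℓ (t i z))
          (bddAbove_range_of_abs_le fun i => hb2 i z) i
        linarith
    _ = ∫ z, ((⨆ i, (g i + 2 * ℓ (t i z))) + (⨆ i, (g i - 2 * ℓ (t i z)))) / 2 ∂μ := by
        rw [integral_div, integral_div, integral_add (integrable_const _) i2, integral_add i1 i2]
        simp
    _ ≤ _ := by
        refine integral_mono ((i1.add i2).div_const 2) ((i3.add i4).div_const 2) fun z => ?_
        have := iSup_add_iSup_le_of_lipschitz hℓ hg fun i => ht i z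
        simp only
        linarith

set_option maxHeartbeats 1000000 in
/-- The expected maximal deviation of the empirical from the true risk over linear functionals of
norm at most `lam`, offset by a linear functional to allow induction on the sample size. -/
theorem integral_iSup_deviation_le {Z ι G : Type*} [MeasurableSpace Z] (μ : Measure Z)
    [IsProbabilityMeasure μ] [Countable ι] [Nonempty ι] [NormedAddCommGroup G]
    [InnerProductSpace ℝ G] {ℓ : ℝ → ℝ} {α : ℝ≥0} (hℓ : LipschitzWith α ℓ) {ψ : Z → G}
    (hψ : StronglyMeasurable ψ) {K lam : ℝ} (hK : ∀ z, ‖ψ z‖ ≤ K) (hlam : 0 ≤ lam)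
    {w : ι → G} (hw : ∀ i, ‖w i‖ ≤ lam) (m : ℕ) (x : G) :
    ∫ S : Fin m → Z, (⨆ i, (2 * α * ⟪w i, x⟫_ℝ +
        ∑ s, ((∫ z, ℓ ⟪w i, ψ z⟫_ℝ ∂μ) - ℓ ⟪w i, ψ (S s)⟫_ℝ))) ∂Measure.pi (fun _ => μ) ≤
      2 * α * lam * √(‖x‖ ^ 2 + m * K ^ 2) := by
  have hα : (0 : ℝ) ≤ α := α.2
  have hlm : Measurable ℓ := hℓ.continuous.measurable
  have hip : ∀ i y, |⟪w i, y⟫_ℝ| ≤ lam * ‖y‖ := fun i y =>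
    (abs_real_inner_le_norm _ _).trans (mul_le_mul_of_nonneg_right (hw i) (norm_nonneg _))
  have ht : ∀ i z, |⟪w i, ψ z⟫_ℝ| ≤ lam * K := fun i z =>
    (hip i _).trans (mul_le_mul_of_nonneg_left (hK z) hlam)
  have htm : ∀ i, Measurable fun z => ⟪w i, ψ z⟫_ℝ := fun i =>
    (stronglyMeasurable_const.inner hψ).measurable
  have hlt : ∀ i, Measurable fun z => ℓ ⟪w i, ψ z⟫_ℝ := fun i => hlm.comp (htm i)
  obtain ⟨D, hD⟩ : ∃ D, ∀ i z, |ℓ ⟪w i, ψ z⟫_ℝ| ≤ D := by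
    refine ⟨|ℓ 0| + α * (lam * K), fun i z => ?_⟩
    have h1 := hℓ.dist_le_mul ⟪w i, ψ z⟫_ℝ 0
    rw [Real.dist_eq, Real.dist_eq, sub_zero] at h1
    have h2 := abs_sub_abs_le_abs_sub (ℓ ⟪w i, ψ z⟫_ℝ) (ℓ 0)
    have h3 := mul_le_mul_of_nonneg_left (ht i z) hα
    linarith
  have hE : ∀ i, |∫ z', ℓ ⟪w i, ψ z'⟫_ℝ ∂μ| ≤ D := fun i => abs_integral_le_of_abs_le (hD i)
  set F : ι → Z → ℝ := fun i z => (∫ z, ℓ ⟪w i, ψ z⟫_ℝ ∂μ) - ℓ ⟪w i, ψ z⟫_ℝ with hF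
  have hFm : ∀ i, Measurable (F i) := fun i => (hlt i).const_sub _
  have hFb : ∀ i z, |F i z| ≤ 2 * D := fun i z => by
    have := abs_sub (∫ z', ℓ ⟪w i, ψ z'⟫_ℝ ∂μ) (ℓ ⟪w i, ψ z⟫_ℝ)
    simp only [hF]
    linarith [hD i z, hE i]
  have hSm : ∀ i (n : ℕ), Measurable fun S : Fin n → Z => ∑ s, F i (S s) := fun i n =>
    Finset.measurable_sum _ fun s _ => (hFm i).comp (measurable_pi_apply s)
  have hSb : ∀ i (n : ℕ) (S : Fin n → Z), |∑ s, F i (S s)| ≤ n * (2 * D) := fun i n S => by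
    refine (Finset.abs_sum_le_sum_abs _ _).trans ?_
    refine (Finset.sum_le_sum fun s _ => hFb i (S s)).trans ?_
    simp
  have hxb : ∀ i y, |2 * α * ⟪w i, y⟫_ℝ| ≤ 2 * α * (lam * ‖y‖) := fun i y => by
    rw [abs_mul, abs_of_nonneg (by positivity : (0 : ℝ) ≤ 2 * α)]
    exact mul_le_mul_of_nonneg_left (hip i y) (by positivity)
  have hgb : ∀ i (n : ℕ) y (S : Fin n → Z), |2 * α * ⟪w i, y⟫_ℝ + ∑ s, F i (S s)| ≤
      2 * α * (lam * ‖y‖) + n * (2 * D) := fun i n y S =>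
    (abs_add_le _ _).trans (add_le_add (hxb i y) (hSb i n S))
  induction m generalizing x with
  | zero =>
    simp only [Finset.univ_eq_empty, Finset.sum_empty, add_zero, integral_const, probReal_univ,
      smul_eq_mul, one_mul, Nat.cast_zero, zero_mul, Real.sqrt_sq (norm_nonneg x)]
    refine ciSup_le fun i => ?_
    have := (abs_le.1 (hxb i x)).2
    linarith
  | succ m ih =>
    have hyb : ∀ z ε, |ε| ≤ (1 : ℝ) → ‖x + ε • ψ z‖ ≤ ‖x‖ + K := fun z ε hε => by
      refine (norm_add_le _ _).trans (add_le_add le_rfl ?_)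
      rw [norm_smul]
      exact (mul_le_of_le_one_left (norm_nonneg _) hε).trans (hK z)
    have hmeas : ∀ ε : ℝ, Measurable fun p : Z × (Fin m → Z) =>
        ⨆ i, (2 * α * ⟪w i, x + ε • ψ p.1⟫_ℝ + ∑ s, F i (p.2 s)) := fun ε =>
      Measurable.iSup fun i => ((((stronglyMeasurable_const.inner (𝕜 := ℝ)
        (stronglyMeasurable_const.add (hψ.const_smul ε))).measurable.comp
          measurable_fst)).const_mul _).add ((hSm i m).comp measurable_snd)
    have hbd : ∀ ε : ℝ, |ε| ≤ 1 → ∀ p : Z × (Fin m → Z),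
        |⨆ i, (2 * α * ⟪w i, x + ε • ψ p.1⟫_ℝ + ∑ s, F i (p.2 s))| ≤
          2 * α * (lam * (‖x‖ + K)) + m * (2 * D) := fun ε hε p => by
      refine abs_iSup_le_of_abs_le fun i => (hgb i m _ _).trans ?_
      have := hyb p.1 ε hε
      gcongr
    have hint : ∀ ε : ℝ, |ε| ≤ 1 → Integrable (fun p : Z × (Fin m → Z) =>
        ⨆ i, (2 * α * ⟪w i, x + ε • ψ p.1⟫_ℝ + ∑ s, F i (p.2 s)))
          (μ.prod (Measure.pi fun _ => μ)) := fun ε hε => integrable_of_abs_le (hmeas ε) (hbd ε hε)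
    have hint0 : Integrable (fun p : Z × (Fin m → Z) =>
        ⨆ i, (2 * α * ⟪w i, x⟫_ℝ + (F i p.1 + ∑ s, F i (p.2 s))))
          (μ.prod (Measure.pi fun _ => μ)) := by
      refine integrable_of_abs_le (C := 2 * α * (lam * ‖x‖) + (2 * D + m * (2 * D)))
        (Measurable.iSup fun i => (((hFm i).comp measurable_fst).add
          ((hSm i m).comp measurable_snd)).const_add _) fun p => abs_iSup_le_of_abs_le fun i => ?_
      exact (abs_add_le _ _).trans (add_le_add (hxb i x)
        ((abs_add_le _ _).trans (add_le_add (hFb i _) (hSb i m _))))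
    have hp := hint 1 (by simp)
    have hn := hint (-1) (by simp)
    have hpn : Integrable (fun p : Z × (Fin m → Z) =>
        ((⨆ i, (2 * α * ⟪w i, x + (1 : ℝ) • ψ p.1⟫_ℝ + ∑ s, F i (p.2 s))) +
          (⨆ i, (2 * α * ⟪w i, x + (-1 : ℝ) • ψ p.1⟫_ℝ + ∑ s, F i (p.2 s)))) / 2)
          (μ.prod (Measure.pi fun _ => μ)) := (hp.add hn).div_const 2
    rw [integral_pi_succ]
    simp only [Fin.sum_univ_succ, Fin.cons_zero, Fin.cons_succ]
    -- With the other observations frozen into the offset `g`, the first one is symmetrized and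
    -- turns the offset vector `x` into `x ± ψ z`. Exchanging the integrals fixes `z`, so that the
    -- induction hypothesis applies at these two vectors.
    calc ∫ p : Z × (Fin m → Z), (⨆ i, (2 * α * ⟪w i, x⟫_ℝ + (F i p.1 + ∑ s, F i (p.2 s))))
          ∂(μ.prod (Measure.pi fun _ => μ))
        = ∫ S : Fin m → Z, ∫ z, (⨆ i, (2 * α * ⟪w i, x⟫_ℝ + (F i z + ∑ s, F i (S s)))) ∂μ
            ∂(Measure.pi fun _ => μ) := integral_prod_symm _ hint0
      _ ≤ ∫ S : Fin m → Z, ∫ z, ((⨆ i, (2 * α * ⟪w i, x + (1 : ℝ) • ψ z⟫_ℝ + ∑ s, F i (S s))) +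
            (⨆ i, (2 * α * ⟪w i, x + (-1 : ℝ) • ψ z⟫_ℝ + ∑ s, F i (S s)))) / 2 ∂μ
            ∂(Measure.pi fun _ => μ) := by
          refine integral_mono hint0.integral_prod_right
            hpn.integral_prod_right fun S => ?_
          have := integral_iSup_le_integral_symmetrized μ hℓ htm ht
            (g := fun i => 2 * α * ⟪w i, x⟫_ℝ + ∑ s, F i (S s)) (hgb · m x S)
          refine (Eq.le ?_).trans (this.trans (Eq.le ?_))
          · refine integral_congr_ae (Filter.Eventually.of_forall fun z => ?_)
            simp only [hF]
            congr 1
            funext i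
            ring
          · refine integral_congr_ae (Filter.Eventually.of_forall fun z => ?_)
            simp only [inner_add_right, inner_smul_right]
            congr 2 <;> (congr 1; funext i; ring)
      _ = ∫ z, ∫ S : Fin m → Z, ((⨆ i, (2 * α * ⟪w i, x + (1 : ℝ) • ψ z⟫_ℝ + ∑ s, F i (S s))) +
            (⨆ i, (2 * α * ⟪w i, x + (-1 : ℝ) • ψ z⟫_ℝ + ∑ s, F i (S s)))) / 2
            ∂(Measure.pi fun _ => μ) ∂μ :=
          (integral_integral_swap hpn).symm
      _ ≤ ∫ _z, 2 * α * lam * √(‖x‖ ^ 2 + (m + 1 : ℕ) * K ^ 2) ∂μ := by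
          refine integral_mono hpn.integral_prod_left
            (integrable_const _) fun z => ?_
          have hsec : ∀ ε : ℝ, |ε| ≤ 1 → Integrable (fun S : Fin m → Z =>
              ⨆ i, (2 * α * ⟪w i, x + ε • ψ z⟫_ℝ + ∑ s, F i (S s))) (Measure.pi fun _ => μ) :=
            fun ε hε => integrable_of_abs_le ((hmeas ε).comp measurable_prodMk_left)
              fun S => hbd ε hε (z, S)
          simp only
          rw [integral_div, integral_add (hsec 1 (by simp)) (hsec (-1) (by simp))]
          have h1 := ih (x + (1 : ℝ) • ψ z)
          have h2 := ih (x + (-1 : ℝ) • ψ z)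
          have n1 : ‖x + (1 : ℝ) • ψ z‖ ^ 2 = ‖x‖ ^ 2 + 2 * ⟪x, ψ z⟫_ℝ + ‖ψ z‖ ^ 2 := by
            rw [one_smul, norm_add_sq_real]
          have n2 : ‖x + (-1 : ℝ) • ψ z‖ ^ 2 = ‖x‖ ^ 2 - 2 * ⟪x, ψ z⟫_ℝ + ‖ψ z‖ ^ 2 := by
            rw [neg_one_smul, ← sub_eq_add_neg, norm_sub_sq_real]
          have hsq : ‖ψ z‖ ^ 2 ≤ K ^ 2 := pow_le_pow_left₀ (norm_nonneg _) (hK z) 2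
          set a := √(‖x + (1 : ℝ) • ψ z‖ ^ 2 + m * K ^ 2) with ha
          set b := √(‖x + (-1 : ℝ) • ψ z‖ ^ 2 + m * K ^ 2) with hb
          have ha2 : a ^ 2 = ‖x + (1 : ℝ) • ψ z‖ ^ 2 + m * K ^ 2 := Real.sq_sqrt (by positivity)
          have hb2 : b ^ 2 = ‖x + (-1 : ℝ) • ψ z‖ ^ 2 + m * K ^ 2 := Real.sq_sqrt (by positivity)
          -- Since `((a + b) / 2)² ≤ (a² + b²) / 2`, the cross terms `± 2 ⟪x, ψ z⟫` cancel and one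
          -- more `K²` appears under the root.
          have hab : (a + b) / 2 ≤ √(‖x‖ ^ 2 + (m + 1 : ℕ) * K ^ 2) := by
            refine Real.le_sqrt_of_sq_le ?_
            push_cast
            nlinarith [sq_nonneg (a - b)]
          have := mul_le_mul_of_nonneg_left hab (by positivity : 0 ≤ 2 * α * lam)
          refine le_trans ?_ this
          linarith
      _ = _ := by simp

/-! ### McDiarmid's inequality -/

/-- Averaging over all coordinates but the first leaves a function `g` of oscillation at most `c`,
to which Hoeffding's lemma applies. With the first coordinate fixed, `f - g` falls under the
induction hypothesis, and the two exponential bounds multiply. -/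
theorem integral_exp_le_of_bounded_differences {Z : Type*} [MeasurableSpace Z] (μ : Measure Z)
    [IsProbabilityMeasure μ] {c C : ℝ} (hc : 0 ≤ c) {m : ℕ} {f : (Fin m → Z) → ℝ}
    (hf : Measurable f) (hC : ∀ S, |f S| ≤ C)
    (hd : ∀ S s z, f (Function.update S s z) - f S ≤ c) (t : ℝ) :
    ∫ S, Real.exp (t * (f S - ∫ S', f S' ∂Measure.pi (fun _ => μ))) ∂Measure.pi (fun _ => μ) ≤
      Real.exp (m * (c / 2) ^ 2 * t ^ 2 / 2) := by
  induction m with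
  | zero =>
    have h : ∀ S, f S = f default := fun S => congrArg f (Subsingleton.elim _ _)
    simp [h]
  | succ m ih =>
    set ν : Measure (Fin m → Z) := Measure.pi fun _ => μ with hν
    have hfm : Measurable fun p : Z × (Fin m → Z) => f (Fin.cons p.1 p.2) :=
      hf.comp measurable_finCons
    have hfi : Integrable (fun p : Z × (Fin m → Z) => f (Fin.cons p.1 p.2)) (μ.prod ν) :=
      integrable_of_abs_le hfm fun p => hC _
    set g : Z → ℝ := fun z => ∫ S, f (Fin.cons z S) ∂ν with hg
    have hgm : Measurable g := hfm.stronglyMeasurable.integral_prod_right.measurable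
    have hgC : ∀ z, |g z| ≤ C := fun z => abs_integral_le_of_abs_le fun S => hC _
    have hsec : ∀ z, Measurable fun S : Fin m → Z => f (Fin.cons z S) := fun z =>
      hfm.comp measurable_prodMk_left
    have hEf : ∫ S, f S ∂Measure.pi (fun _ => μ) = ∫ z, g z ∂μ := by
      rw [integral_pi_succ, integral_prod _ hfi]
    have hgd : ∀ z z', g z - g z' ≤ c := fun z z' => by
      rw [hg, ← integral_sub (integrable_of_abs_le (hsec z) fun S => hC _)
        (integrable_of_abs_le (hsec z') fun S => hC _)]
      refine (integral_mono (g := fun _ => c)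
        ((integrable_of_abs_le (hsec z) fun S => hC _).sub
        (integrable_of_abs_le (hsec z') fun S => hC _)) (integrable_const _) fun S => ?_).trans ?_
      · have := hd (Fin.cons z' S) 0 z
        rwa [Fin.update_cons_zero] at this
      · simp
    have hgb : BddBelow (Set.range g) :=
      ⟨-C, by rintro _ ⟨z, rfl⟩; exact (abs_le.1 (hgC z)).1⟩
    have : Nonempty Z := nonempty_of_isProbabilityMeasure μ
    -- Oscillation at most `c` confines `g` to an interval of length `c` starting at its infimum.
    have hIcc : ∀ z, g z ∈ Set.Icc (⨅ z, g z) ((⨅ z, g z) + c) := fun z =>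
      ⟨ciInf_le hgb z, by
        have : g z - c ≤ ⨅ z, g z := le_ciInf fun z' => by linarith [hgd z z']
        linarith⟩
    have hoeff := ProbabilityTheory.hasSubgaussianMGF_of_mem_Icc (μ := μ) hgm.aemeasurable
      (Filter.Eventually.of_forall hIcc)
    have hmgf : ∫ z, Real.exp (t * (g z - ∫ z, g z ∂μ)) ∂μ ≤
        Real.exp ((c / 2) ^ 2 * t ^ 2 / 2) := by
      have := hoeff.mgf_le t
      simpa [ProbabilityTheory.mgf, abs_of_nonneg hc] using this
    have hinner : ∀ z, ∫ S, Real.exp (t * (f (Fin.cons z S) - g z)) ∂ν ≤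
        Real.exp (m * (c / 2) ^ 2 * t ^ 2 / 2) := fun z => by
      refine ih (hsec z) (fun S => hC _) fun S s z' => ?_
      have := hd (Fin.cons z S) s.succ z'
      rwa [← Fin.cons_update] at this
    have hexpi : Integrable (fun p : Z × (Fin m → Z) =>
        Real.exp (t * (f (Fin.cons p.1 p.2) - ∫ z, g z ∂μ))) (μ.prod ν) := by
      refine integrable_of_abs_le (C := Real.exp (|t| * (C + C)))
        (Real.measurable_exp.comp ((hfm.sub_const _).const_mul t)) fun p => ?_
      rw [Real.abs_exp, Real.exp_le_exp]
      refine (le_abs_self _).trans ?_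
      rw [abs_mul]
      exact mul_le_mul_of_nonneg_left ((abs_sub _ _).trans
        (add_le_add (hC _) (abs_integral_le_of_abs_le hgC))) (abs_nonneg t)
    rw [hEf, integral_pi_succ, integral_prod _ hexpi]
    calc ∫ z, ∫ S, Real.exp (t * (f (Fin.cons z S) - ∫ z, g z ∂μ)) ∂ν ∂μ
        ≤ ∫ z, Real.exp (t * (g z - ∫ z, g z ∂μ)) *
            Real.exp (m * (c / 2) ^ 2 * t ^ 2 / 2) ∂μ := by
          refine integral_mono hexpi.integral_prod_left
            ((hoeff.integrable_exp_mul t).mul_const _) fun z => ?_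
          have : ∀ S, Real.exp (t * (f (Fin.cons z S) - ∫ z, g z ∂μ)) =
              Real.exp (t * (g z - ∫ z, g z ∂μ)) * Real.exp (t * (f (Fin.cons z S) - g z)) :=
            fun S => by rw [← Real.exp_add]; congr 1; ring
          simp only [this, integral_const_mul]
          exact mul_le_mul_of_nonneg_left (hinner z) (Real.exp_nonneg _)
      _ ≤ Real.exp ((c / 2) ^ 2 * t ^ 2 / 2) * Real.exp (m * (c / 2) ^ 2 * t ^ 2 / 2) := by
          rw [integral_mul_const]
          exact mul_le_mul_of_nonneg_right hmgf (Real.exp_nonneg _)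
      _ = _ := by
          rw [← Real.exp_add]
          congr 1
          push_cast
          ring

/-- **McDiarmid's inequality** for a bounded function of finitely many i.i.d. variables. -/
theorem measureReal_ge_le_of_bounded_differences {Z : Type*} [MeasurableSpace Z] (μ : Measure Z)
    [IsProbabilityMeasure μ] {c C : ℝ} (hc : 0 ≤ c) {m : ℕ} {f : (Fin m → Z) → ℝ}
    (hf : Measurable f) (hC : ∀ S, |f S| ≤ C)
    (hd : ∀ S s z, f (Function.update S s z) - f S ≤ c) {ε : ℝ} (hε : 0 ≤ ε) :
    (Measure.pi fun _ : Fin m => μ).real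
        {S | ε ≤ f S - ∫ S', f S' ∂Measure.pi (fun _ => μ)} ≤
      Real.exp (-ε ^ 2 / (2 * (m * (c / 2) ^ 2))) := by
  lift c to ℝ≥0 using hc
  have h : ProbabilityTheory.HasSubgaussianMGF
      (fun S => f S - ∫ S', f S' ∂Measure.pi (fun _ => μ)) (m * (c / 2) ^ 2)
      (Measure.pi fun _ : Fin m => μ) := by
    refine ⟨fun t => ?_, fun t => ?_⟩
    · refine integrable_of_abs_le (C := Real.exp (|t| * (C + C)))
        (Real.measurable_exp.comp ((hf.sub_const _).const_mul t)) fun S => ?_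
      rw [Real.abs_exp, Real.exp_le_exp]
      refine (le_abs_self _).trans ?_
      rw [abs_mul]
      exact mul_le_mul_of_nonneg_left ((abs_sub _ _).trans
        (add_le_add (hC _) (abs_integral_le_of_abs_le hC))) (abs_nonneg t)
    · simpa [ProbabilityTheory.mgf] using integral_exp_le_of_bounded_differences μ c.2 hf hC hd t
  simpa using h.measure_ge_le hε

/-! ### A uniform risk bound for bounded linear functionals -/

theorem sum_comp_update {Z : Type*} {m : ℕ} (h : Z → ℝ) (S : Fin m → Z) (s : Fin m) (z : Z) :
    ∑ s', h (Function.update S s z s') = ∑ s', h (S s') + (h z - h (S s)) := by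
  rw [← Finset.add_sum_erase _ _ (Finset.mem_univ s),
    ← Finset.add_sum_erase (a := s) _ (fun s' => h (S s')) (Finset.mem_univ s),
    Finset.sum_congr rfl fun s' hs' => by rw [Function.update_of_ne (Finset.ne_of_mem_erase hs')],
    Function.update_self]
  ring

theorem abs_sub_le_of_lipschitz {ℓ : ℝ → ℝ} {α : ℝ≥0} (hℓ : LipschitzWith α ℓ) (x y : ℝ) :
    |ℓ x - ℓ y| ≤ α * |x - y| := by
  simpa [Real.dist_eq] using hℓ.dist_le_mul x y

/-- McDiarmid is applied once, to `X - Y`: `X` is the supremal summed deviation over a countable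
dense subset of the ball, which keeps it measurable, and `Y` is the deviation at the fixed `v`, of
mean zero. The joint application avoids a union bound and yields `log (1 / δ)`. Continuity in `w`
extends the estimate to the whole ball. -/
theorem exists_uniform_risk_bound {Z G : Type*} [MeasurableSpace Z] (μ : Measure Z)
    [IsProbabilityMeasure μ] [NormedAddCommGroup G] [InnerProductSpace ℝ G]
    [TopologicalSpace.SeparableSpace G] {ℓ : ℝ → ℝ} {α : ℝ≥0} (hℓ : LipschitzWith α ℓ) {ψ : Z → G}
    (hψ : StronglyMeasurable ψ) {K lam : ℝ} (hK : ∀ z, ‖ψ z‖ ≤ K) {v : G} (hv : ‖v‖ ≤ lam)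
    {m : ℕ} (hm : 0 < m) {δ : ℝ} (hδ : 0 < δ) (hδ' : δ ≤ 1) :
    ∃ E : Set (Fin m → Z), MeasurableSet E ∧
      ENNReal.ofReal (1 - δ) ≤ Measure.pi (fun _ : Fin m => μ) E ∧
      ∀ S ∈ E, ∀ w : G, ‖w‖ ≤ lam →
        ((∫ z, ℓ ⟪w, ψ z⟫_ℝ ∂μ) - 1 / (m : ℝ) * ∑ s, ℓ ⟪w, ψ (S s)⟫_ℝ) +
          (1 / (m : ℝ) * ∑ s, ℓ ⟪v, ψ (S s)⟫_ℝ - (∫ z, ℓ ⟪v, ψ z⟫_ℝ ∂μ)) ≤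
        2 * (α * lam * K) / √m + 2 * (α * lam * K) * √(2 * Real.log (1 / δ) / m) := by
  have hα : (0 : ℝ) ≤ α := α.2
  have hlam : 0 ≤ lam := (norm_nonneg v).trans hv
  have hm' : (0 : ℝ) < m := Nat.cast_pos.2 hm
  obtain ⟨z₀⟩ := nonempty_of_isProbabilityMeasure μ
  have hK0 : 0 ≤ K := (norm_nonneg _).trans (hK z₀)
  have hip : ∀ w y : G, ∀ z, |⟪w, ψ z⟫_ℝ - ⟪y, ψ z⟫_ℝ| ≤ ‖w - y‖ * K := fun w y z => by
    rw [← inner_sub_left]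
    exact (abs_real_inner_le_norm _ _).trans (mul_le_mul_of_nonneg_left (hK z) (norm_nonneg _))
  have hdiff : ∀ w y : G, ∀ z, |ℓ ⟪w, ψ z⟫_ℝ - ℓ ⟪y, ψ z⟫_ℝ| ≤ α * K * ‖w - y‖ :=
    fun w y z => (abs_sub_le_of_lipschitz hℓ _ _).trans (by
      have := mul_le_mul_of_nonneg_left (hip w y z) hα
      linarith)
  have hrange : ∀ w : G, ‖w‖ ≤ lam → ∀ z z', ℓ ⟪w, ψ z⟫_ℝ - ℓ ⟪w, ψ z'⟫_ℝ ≤ 2 * (α * lam * K) :=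
    fun w hw z z' => by
      refine (le_abs_self _).trans ((abs_sub_le_of_lipschitz hℓ _ _).trans ?_)
      have h : ∀ z, |⟪w, ψ z⟫_ℝ| ≤ lam * K := fun z => (abs_real_inner_le_norm _ _).trans
        (mul_le_mul hw (hK z) (norm_nonneg _) hlam)
      have := mul_le_mul_of_nonneg_left ((abs_sub _ _).trans (add_le_add (h z) (h z'))) hα
      linarith
  have hlt : ∀ w : G, Measurable fun z => ℓ ⟪w, ψ z⟫_ℝ := fun w =>
    hℓ.continuous.measurable.comp (stronglyMeasurable_const.inner hψ).measurable
  have hbd : ∀ w : G, ∀ z, |ℓ ⟪w, ψ z⟫_ℝ| ≤ |ℓ 0| + α * K * ‖w‖ := fun w z => by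
    have h1 := hdiff w 0 z
    have h2 := abs_sub_abs_le_abs_sub (ℓ ⟪w, ψ z⟫_ℝ) (ℓ 0)
    simp only [inner_zero_left, sub_zero] at h1
    linarith
  have hbd' : ∀ w : G, ‖w‖ ≤ lam → ∀ z, |ℓ ⟪w, ψ z⟫_ℝ| ≤ |ℓ 0| + α * K * lam := fun w hw z =>
    (hbd w z).trans (by gcongr)
  have hint : ∀ w : G, Integrable (fun z => ℓ ⟪w, ψ z⟫_ℝ) μ := fun w =>
    integrable_of_abs_le (hlt w) (hbd w)
  -- In the degenerate case all losses on the ball coincide. It is set apart because the exponent in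
  -- McDiarmid's bound divides by `c`.
  by_cases ha : α * lam * K = 0
  · refine ⟨Set.univ, MeasurableSet.univ, ?_, fun S _ w hw => ?_⟩
    · rw [measure_univ]
      exact ENNReal.ofReal_le_one.2 (by linarith)
    · have heq : ∀ z, ℓ ⟪w, ψ z⟫_ℝ = ℓ ⟪v, ψ z⟫_ℝ := fun z => by
        have h1 := hdiff w v z
        have h2 : α * K * ‖w - v‖ ≤ α * K * (lam + lam) :=
          mul_le_mul_of_nonneg_left ((norm_sub_le _ _).trans (add_le_add hw hv)) (by positivity)
        have h3 : |ℓ ⟪w, ψ z⟫_ℝ - ℓ ⟪v, ψ z⟫_ℝ| ≤ 0 := h1.trans (h2.trans (by nlinarith))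
        exact sub_eq_zero.1 (abs_eq_zero.1 (le_antisymm h3 (abs_nonneg _)))
      simp [heq, ha]
  have hapos : 0 < α * lam * K := lt_of_le_of_ne (by positivity) (Ne.symm ha)
  have hne : (Metric.closedBall (0 : G) lam).Nonempty := ⟨0, by simpa using hlam⟩
  have : Nonempty (Metric.closedBall (0 : G) lam) := hne.to_subtype
  have : SecondCountableTopology G := UniformSpace.secondCountable_of_separable G
  set w : ℕ → G := fun n =>
    (TopologicalSpace.denseSeq (Metric.closedBall (0 : G) lam) n : G) with hwdef
  have hw : ∀ n, ‖w n‖ ≤ lam := fun n => by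
    exact mem_closedBall_zero_iff.1 (TopologicalSpace.denseSeq (Metric.closedBall (0 : G) lam) n).2
  set R : G → ℝ := fun w => ∫ z, ℓ ⟪w, ψ z⟫_ℝ ∂μ with hR
  have hRb : ∀ w : G, ‖w‖ ≤ lam → |R w| ≤ |ℓ 0| + α * K * lam := fun w hw =>
    abs_integral_le_of_abs_le (hbd' w hw)
  set C := 2 * (|ℓ 0| + α * K * lam) with hC
  have hsum : ∀ w : G, ‖w‖ ≤ lam → ∀ S : Fin m → Z,
      |∑ s, (R w - ℓ ⟪w, ψ (S s)⟫_ℝ)| ≤ m * C := fun w hw S => by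
    refine (Finset.abs_sum_le_sum_abs _ _).trans ?_
    refine (Finset.sum_le_sum (g := fun _ => C) fun s _ => (abs_sub _ _).trans ?_).trans ?_
    · rw [hC, two_mul]
      exact add_le_add (hRb w hw) (hbd' w hw _)
    · simp
  have hsm : ∀ w : G, Measurable fun S : Fin m → Z => ∑ s, (R w - ℓ ⟪w, ψ (S s)⟫_ℝ) := fun w =>
    Finset.measurable_sum _ fun s _ => ((hlt w).const_sub (R w)).comp (measurable_pi_apply s)
  set X : (Fin m → Z) → ℝ := fun S => ⨆ i, ∑ s, (R (w i) - ℓ ⟪w i, ψ (S s)⟫_ℝ) with hX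
  have hXm : Measurable X := Measurable.iSup fun i => hsm (w i)
  have hXb : ∀ S, |X S| ≤ m * C := fun S => abs_iSup_le_of_abs_le fun i => hsum _ (hw i) S
  set Y : (Fin m → Z) → ℝ := fun S => ∑ s, (R v - ℓ ⟪v, ψ (S s)⟫_ℝ) with hY
  have hXi : Integrable X (Measure.pi fun _ : Fin m => μ) := integrable_of_abs_le hXm hXb
  have hYi : Integrable Y (Measure.pi fun _ : Fin m => μ) := integrable_of_abs_le (hsm v) (hsum v hv)
  have hEX : ∫ S, X S ∂Measure.pi (fun _ : Fin m => μ) ≤ 2 * (α * lam * K) * √m := by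
    have h := integral_iSup_deviation_le μ hℓ hψ hK hlam hw m (0 : G)
    simp only [inner_zero_right, mul_zero, zero_add, norm_zero, ne_eq, OfNat.ofNat_ne_zero,
      not_false_eq_true, zero_pow, Real.sqrt_mul hm'.le, Real.sqrt_sq hK0] at h
    linarith
  have hEY : ∫ S, Y S ∂Measure.pi (fun _ : Fin m => μ) = 0 := by
    rw [hY, integral_finsetSum]
    · refine Finset.sum_eq_zero fun s _ => ?_
      rw [integral_comp_eval (μ := fun _ : Fin m => μ) (i := s) (f := fun z => R v - ℓ ⟪v, ψ z⟫_ℝ)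
        ((hlt v).const_sub _).aestronglyMeasurable,
        integral_sub (integrable_const _) (hint v)]
      simp [hR]
    · intro s _
      exact integrable_of_abs_le (((hlt v).const_sub (R v)).comp (measurable_pi_apply s))
        fun S => (abs_sub _ _).trans (add_le_add (hRb v hv) (hbd' v hv _))
  have hXd : ∀ S s z, X (Function.update S s z) ≤ X S + 2 * (α * lam * K) := fun S s z => by
    refine ciSup_le fun i => ?_
    rw [sum_comp_update (fun z => R (w i) - ℓ ⟪w i, ψ z⟫_ℝ)]
    have h1 := le_ciSup (f := fun i => ∑ s, (R (w i) - ℓ ⟪w i, ψ (S s)⟫_ℝ))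
      (bddAbove_range_of_abs_le fun i => hsum _ (hw i) S) i
    have h2 := hrange (w i) (hw i) (S s) z
    simp only [hX]
    linarith
  have hYd : ∀ S s z, Y S ≤ Y (Function.update S s z) + 2 * (α * lam * K) := fun S s z => by
    simp only [hY]
    rw [sum_comp_update (fun z => R v - ℓ ⟪v, ψ z⟫_ℝ)]
    have h2 := hrange v hv z (S s)
    linarith
  -- Replacing one observation moves `X` and `Y` by at most `2 α lam K` each. The value of `ε` below
  -- solves `exp (-ε² / (2 m (c / 2)²)) = δ`.
  set c := 4 * (α * lam * K) with hc
  set ε := c * √(m * Real.log (1 / δ) / 2) with hε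
  have hmc := measureReal_ge_le_of_bounded_differences μ (c := c) (C := m * C + m * C)
    (by positivity) (f := fun S => X S - Y S)
    (hXm.sub (hsm v)) (fun S => (abs_sub _ _).trans (add_le_add (hXb S) (hsum v hv S)))
    (fun S s z => by linarith [hXd S s z, hYd S s z]) (ε := ε) (by positivity)
  have hlog : 0 ≤ Real.log (1 / δ) := Real.log_nonneg (by rw [le_div_iff₀ hδ]; linarith)
  have hexp : Real.exp (-ε ^ 2 / (2 * (m * (c / 2) ^ 2))) = δ := by
    have hcpos : 0 < c := by positivity
    have : -ε ^ 2 / (2 * (m * (c / 2) ^ 2)) = Real.log δ := by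
      rw [hε, mul_pow, Real.sq_sqrt (by positivity), one_div, Real.log_inv]
      field_simp
    rw [this, Real.exp_log hδ]
  rw [hexp] at hmc
  set E : Set (Fin m → Z) :=
    {S | ε ≤ X S - Y S - ∫ S', (X S' - Y S') ∂Measure.pi (fun _ : Fin m => μ)} with hE
  have hEm : MeasurableSet E :=
    measurableSet_le measurable_const ((hXm.sub (hsm v)).sub_const _)
  refine ⟨Eᶜ, hEm.compl, ?_, fun S hS y hy => ?_⟩
  · rw [← ofReal_measureReal]
    refine ENNReal.ofReal_le_ofReal ?_
    rw [probReal_compl_eq_one_sub hEm]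
    linarith
  · have hS' : X S - Y S < ε + 2 * (α * lam * K) * √m := by
      rw [hE, Set.mem_compl_iff, Set.mem_ofPred_eq] at hS
      rw [integral_sub hXi hYi, hEY] at hS
      linarith
    have hsplit : ∀ y : G, ∑ s, (R y - ℓ ⟪y, ψ (S s)⟫_ℝ) = m * R y - ∑ s, ℓ ⟪y, ψ (S s)⟫_ℝ :=
      fun y => by simp [Finset.sum_sub_distrib]
    have hRl : LipschitzWith (α * ⟨K, hK0⟩) R := LipschitzWith.of_dist_le_mul fun y y' => by
      rw [Real.dist_eq, dist_eq_norm, hR, ← integral_sub (hint y) (hint y')]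
      exact abs_integral_le_of_abs_le (hdiff y y')
    have hcont : Continuous fun y : Metric.closedBall (0 : G) lam =>
        ∑ s, (R y - ℓ ⟪(y : G), ψ (S s)⟫_ℝ) := by
      have h1 := hRl.continuous
      have h2 := hℓ.continuous
      fun_prop
    have hyX : ∑ s, (R y - ℓ ⟪y, ψ (S s)⟫_ℝ) ≤ X S :=
      (TopologicalSpace.denseRange_denseSeq (Metric.closedBall (0 : G) lam)).induction_on
        (p := fun y => ∑ s, (R y - ℓ ⟪(y : G), ψ (S s)⟫_ℝ) ≤ X S) ⟨y, by simpa using hy⟩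
        (isClosed_le hcont continuous_const) fun i =>
          le_ciSup (f := fun i => ∑ s, (R (w i) - ℓ ⟪w i, ψ (S s)⟫_ℝ))
            (bddAbove_range_of_abs_le fun i => hsum _ (hw i) S) i
    have hYS : Y S = m * R v - ∑ s, ℓ ⟪v, ψ (S s)⟫_ℝ := hsplit v
    rw [hsplit] at hyX
    have hlhs : (R y - 1 / (m : ℝ) * ∑ s, ℓ ⟪y, ψ (S s)⟫_ℝ) +
        (1 / (m : ℝ) * ∑ s, ℓ ⟪v, ψ (S s)⟫_ℝ - R v) =
        ((m * R y - ∑ s, ℓ ⟪y, ψ (S s)⟫_ℝ) - (m * R v - ∑ s, ℓ ⟪v, ψ (S s)⟫_ℝ)) / m := by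
      field_simp
      ring
    have hrhs : 2 * (α * lam * K) / √m + 2 * (α * lam * K) * √(2 * Real.log (1 / δ) / m) =
        (ε + 2 * (α * lam * K) * √m) / m := by
      have h1 : √(m * Real.log (1 / δ) / 2) = m / 2 * √(2 * Real.log (1 / δ) / m) := by
        rw [show m * Real.log (1 / δ) / 2 = (m / 2 : ℝ) ^ 2 * (2 * Real.log (1 / δ) / m) by
          field_simp, Real.sqrt_mul (by positivity), Real.sqrt_sq (by positivity)]
      have h2 : 1 / √m = √m / m := by
        rw [div_eq_div_iff (by positivity) hm'.ne', one_mul, Real.mul_self_sqrt hm'.le]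
      rw [hε, h1, hc, div_eq_mul_one_div, h2]
      field_simp
      ring
    rw [hlhs, hrhs]
    exact div_le_div_of_nonneg_right (by linarith) hm'.le

/-- Separability is dispensable: a strongly measurable `ψ` has separable range, and projecting onto
its closed span preserves every `⟪w, ψ z⟫` without increasing norms. -/
theorem exists_uniform_risk_bound_of_complete {Z G : Type*} [MeasurableSpace Z] (μ : Measure Z)
    [IsProbabilityMeasure μ] [NormedAddCommGroup G] [InnerProductSpace ℝ G] [CompleteSpace G]
    {ℓ : ℝ → ℝ} {α : ℝ≥0} (hℓ : LipschitzWith α ℓ) {ψ : Z → G} (hψ : StronglyMeasurable ψ)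
    {K lam : ℝ} (hK : ∀ z, ‖ψ z‖ ≤ K) {v : G} (hv : ‖v‖ ≤ lam)
    {m : ℕ} (hm : 0 < m) {δ : ℝ} (hδ : 0 < δ) (hδ' : δ ≤ 1) :
    ∃ E : Set (Fin m → Z), MeasurableSet E ∧
      ENNReal.ofReal (1 - δ) ≤ Measure.pi (fun _ : Fin m => μ) E ∧
      ∀ S ∈ E, ∀ w : G, ‖w‖ ≤ lam →
        ((∫ z, ℓ ⟪w, ψ z⟫_ℝ ∂μ) - 1 / (m : ℝ) * ∑ s, ℓ ⟪w, ψ (S s)⟫_ℝ) +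
          (1 / (m : ℝ) * ∑ s, ℓ ⟪v, ψ (S s)⟫_ℝ - (∫ z, ℓ ⟪v, ψ z⟫_ℝ ∂μ)) ≤
        2 * (α * lam * K) / √m + 2 * (α * lam * K) * √(2 * Real.log (1 / δ) / m) := by
  set U : Submodule ℝ G := (Submodule.span ℝ (Set.range ψ)).topologicalClosure with hU
  have hψU : ∀ z, ψ z ∈ U := fun z =>
    Submodule.le_topologicalClosure _ (Submodule.subset_span (Set.mem_range_self z))
  have : TopologicalSpace.SeparableSpace U :=
    (hψ.isSeparable_range.span (R := ℝ)).closure.separableSpace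
  have hUc : CompleteSpace U := (Submodule.isClosed_topologicalClosure _).completeSpace_coe
  have hinner : ∀ w z, ⟪w, ψ z⟫_ℝ =
      ⟪U.orthogonalProjectionOnto w, U.orthogonalProjectionOnto (ψ z)⟫_ℝ := fun w z => by
    rw [Submodule.inner_orthogonalProjectionOnto_eq_of_mem_right,
      Submodule.orthogonalProjectionOnto_mem_subspace_eq_self (⟨ψ z, hψU z⟩ : U)]
  have hle : ∀ w : G, ‖U.orthogonalProjectionOnto w‖ ≤ ‖w‖ :=
    U.norm_orthogonalProjectionOnto_apply_le
  obtain ⟨E, hE, hE', h⟩ := exists_uniform_risk_bound μ hℓ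
    (ψ := fun z => U.orthogonalProjectionOnto (ψ z))
    (U.orthogonalProjectionOnto.continuous.comp_stronglyMeasurable hψ)
    (fun z => (hle _).trans (hK z)) ((hle v).trans hv) hm hδ hδ'
  refine ⟨E, hE, hE', fun S hS w hw => ?_⟩
  simpa only [hinner] using h S hS _ ((hle w).trans hw)

/-! ### The Schatten 2-norm as a Hilbert–Schmidt norm -/

section HilbertSchmidt

variable {H : Type*} [NormedAddCommGroup H] [InnerProductSpace ℝ H] {ι : Type*}

theorem HilbertBasis.tsum_ofReal_inner_sq (b : HilbertBasis ι ℝ H) (x : H) :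
    ∑' i, ENNReal.ofReal (⟪b i, x⟫_ℝ ^ 2) = ENNReal.ofReal (‖x‖ ^ 2) := by
  have h := b.hasSum_inner_mul_inner x x
  have h' : HasSum (fun i => ⟪b i, x⟫_ℝ ^ 2) (‖x‖ ^ 2) := by
    rw [← real_inner_self_eq_norm_sq]
    simpa only [real_inner_comm x, ← sq] using h
  rw [← ENNReal.ofReal_tsum_of_nonneg (fun i => sq_nonneg _) h'.summable, h'.tsum_eq]

/-- The trace of an orthogonal projection is its rank: expand in an orthonormal basis of `F`,
exchange the sums and apply Parseval. -/
theorem HilbertBasis.tsum_ofReal_norm_sq_starProjection (b : HilbertBasis ι ℝ H)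
    (F : Submodule ℝ H) [FiniteDimensional ℝ F] :
    ∑' i, ENNReal.ofReal (‖F.starProjection (b i)‖ ^ 2) = Module.finrank ℝ F := by
  let f := stdOrthonormalBasis ℝ F
  have h : ∀ x, ENNReal.ofReal (‖F.starProjection x‖ ^ 2) =
      ∑ k, ENNReal.ofReal (⟪x, (f k : H)⟫_ℝ ^ 2) := fun x => by
    rw [← ENNReal.ofReal_sum_of_nonneg fun k _ => sq_nonneg _]
    congr 1
    have := f.sum_sq_norm_inner_right (F.orthogonalProjectionOnto x)
    rw [Submodule.starProjection_apply, ← Submodule.coe_norm, ← this]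
    refine Finset.sum_congr rfl fun k _ => ?_
    rw [Submodule.inner_orthogonalProjectionOnto_eq_of_mem_left, Real.norm_eq_abs, sq_abs,
      real_inner_comm]
  simp_rw [h]
  rw [Summable.tsum_finsetSum fun _ _ => ENNReal.summable]
  simp_rw [b.tsum_ofReal_inner_sq]
  have : ∀ k, ‖(f k : H)‖ = 1 := fun k => f.orthonormal.1 k
  simp [this]

variable [CompleteSpace H]

/-- Both sides are the sum of all squared matrix entries of `T`. -/
theorem HilbertBasis.tsum_ofReal_norm_sq_adjoint (b : HilbertBasis ι ℝ H) (T : H →L[ℝ] H) :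
    ∑' i, ENNReal.ofReal (‖(T†) (b i)‖ ^ 2) = ∑' i, ENNReal.ofReal (‖T (b i)‖ ^ 2) := by
  simp_rw [← b.tsum_ofReal_inner_sq]
  rw [ENNReal.tsum_comm]
  refine tsum_congr fun i => tsum_congr fun j => ?_
  rw [ContinuousLinearMap.adjoint_inner_right, real_inner_comm]

/-- Spectral theorem for the compact symmetric operator `T† T`: `‖T x‖² = ⟪T† T x, x⟫`, with `x`
decomposed along the eigenspaces. -/
theorem ofReal_norm_sq_eq_tsum_eigenspace {T : H →L[ℝ] H} (hT : IsCompactOperator T)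
    [∀ μ : Set.Ioi (0 : ℝ), FiniteDimensional ℝ
      (Module.End.eigenspace ((T† ∘L T : H →L[ℝ] H) : H →ₗ[ℝ] H) (μ : ℝ))] (x : H) :
    ENNReal.ofReal (‖T x‖ ^ 2) = ∑' μ : Set.Ioi (0 : ℝ), ENNReal.ofReal (μ : ℝ) *
      ENNReal.ofReal (‖(Module.End.eigenspace ((T† ∘L T : H →L[ℝ] H) : H →ₗ[ℝ] H)
        (μ : ℝ)).starProjection x‖ ^ 2) := by
  set A : H →L[ℝ] H := T† ∘L T with hA
  have hAT : ∀ x y, ⟪x, A y⟫_ℝ = ⟪T x, T y⟫_ℝ := fun x y => by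
    rw [hA, ContinuousLinearMap.comp_apply, ContinuousLinearMap.adjoint_inner_right]
  have hAc : IsCompactOperator A := hT.clm_comp (T†)
  have hAs : (A : H →ₗ[ℝ] H).IsSymmetric := fun x y => by
    rw [ContinuousLinearMap.coe_coe, real_inner_comm, hAT, hAT, real_inner_comm]
  set F : ℝ → Submodule ℝ H := fun μ => Module.End.eigenspace (A : H →ₗ[ℝ] H) μ with hF
  have hmem : ∀ μ y, y ∈ F μ ↔ A y = μ • y := fun μ y => by
    rw [hF, Module.End.mem_eigenspace_iff]; rfl
  have hcl : ∀ μ, CompleteSpace (F μ) := fun μ => by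
    have : IsClosed (F μ : Set H) := by
      have : (F μ : Set H) = {y | A y = μ • y} := Set.ext (hmem μ)
      rw [this]
      exact isClosed_eq A.continuous (continuous_const_smul μ)
    exact this.completeSpace_coe
  -- The sum is indexed by all real numbers; those that are not eigenvalues contribute the zero
  -- subspace.
  have hsum : IsHilbertSum ℝ (fun μ => F μ) fun μ => (F μ).subtypeₗᵢ :=
    IsHilbertSum.mkInternal F hAs.orthogonalFamily_eigenspaces <| by
      rw [Submodule.topologicalClosure_eq_top_iff.2
        (ContinuousLinearMap.orthogonalComplement_iSup_eigenspaces_eq_bot hAc hAs)]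
  set y : ∀ μ, F μ := fun μ => hsum.linearIsometryEquiv x μ with hy
  have hxy : HasSum (fun μ => (y μ : H)) x := by
    have := hsum.hasSum_linearIsometryEquiv_symm (hsum.linearIsometryEquiv x)
    simpa using this
  have hproj : ∀ μ, ∀ f ∈ F μ, ⟪f, (y μ : H)⟫_ℝ = ⟪f, x⟫_ℝ := fun μ f hf => by
    have h1 : HasSum (fun ν => ⟪f, (y ν : H)⟫_ℝ) ⟪f, x⟫_ℝ := hxy.mapL (innerSL ℝ f)
    refine (hasSum_single μ fun ν hν => ?_).unique h1
    exact hAs.orthogonalFamily_eigenspaces hν.symm ⟨f, hf⟩ (y ν)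
  have hAy : ∀ μ, ⟪A x, (y μ : H)⟫_ℝ = μ * ‖(y μ : H)‖ ^ 2 := fun μ => by
    have h1 : ⟪A x, (y μ : H)⟫_ℝ = ⟪x, A (y μ)⟫_ℝ := hAs x (y μ)
    rw [h1, (hmem μ _).1 (y μ).2, inner_smul_right, real_inner_comm,
      ← hproj μ _ (y μ).2, real_inner_self_eq_norm_sq]
  have hTx : HasSum (fun μ => μ * ‖(y μ : H)‖ ^ 2) (‖T x‖ ^ 2) := by
    have h1 : HasSum (fun ν => ⟪A x, (y ν : H)⟫_ℝ) ⟪A x, x⟫_ℝ := hxy.mapL (innerSL ℝ (A x))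
    rw [real_inner_comm, hAT, real_inner_self_eq_norm_sq] at h1
    simpa only [hAy] using h1
  have hnn : ∀ μ, 0 ≤ μ * ‖(y μ : H)‖ ^ 2 := fun μ => by
    have h1 := hAT (y μ) (y μ)
    rw [(hmem μ _).1 (y μ).2, inner_smul_right, real_inner_self_eq_norm_sq,
      real_inner_self_eq_norm_sq] at h1
    rw [h1]
    positivity
  rw [← hTx.tsum_eq, ENNReal.ofReal_tsum_of_nonneg hnn hTx.summable,
    ← tsum_subtype_eq_of_support_subset (s := Set.Ioi 0)]
  · refine tsum_congr fun μ => ?_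
    rw [ENNReal.ofReal_mul (le_of_lt μ.2)]
    congr 4
    exact (Submodule.eq_starProjection_of_mem_of_inner_eq_zero (y μ).2 fun f hf => by
      rw [inner_sub_left, real_inner_comm, real_inner_comm _ (y μ : H), hproj _ f hf,
        sub_self]).symm
  · intro μ hμ
    rw [Function.mem_support, ne_eq, ENNReal.ofReal_eq_zero, not_le] at hμ
    exact pos_of_mul_pos_left hμ (sq_nonneg _)

/-- Summing the spectral formula over the basis and exchanging sums, each eigenvalue `μ` is weighted
by the trace of its eigenprojection, which is its multiplicity. Compactness makes these eigenspaces
finite-dimensional, so that `finrank` is the true dimension. -/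
theorem KernelMetric.schattenNorm_two_eq (b : HilbertBasis ι ℝ H) {T : H →L[ℝ] H}
    (hT : IsCompactOperator T) :
    KernelMetric.schattenNorm 2 T = (∑' i, ENNReal.ofReal (‖T (b i)‖ ^ 2)) ^ (1 / 2 : ℝ) := by
  have hfin : ∀ μ : Set.Ioi (0 : ℝ), FiniteDimensional ℝ
      (Module.End.eigenspace ((T† ∘L T : H →L[ℝ] H) : H →ₗ[ℝ] H) (μ : ℝ)) := fun μ =>
    ContinuousLinearMap.finite_dimensional_eigenspace (hT.clm_comp (T†)) _ (ne_of_gt μ.2)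
  rw [schattenNorm, if_pos hT]
  congr 1
  simp_rw [ofReal_norm_sq_eq_tsum_eigenspace hT]
  rw [ENNReal.tsum_comm]
  refine tsum_congr fun μ => ?_
  rw [ENNReal.tsum_mul_left, b.tsum_ofReal_norm_sq_starProjection, mul_comm,
    ENNReal.rpow_two, ← ENNReal.ofReal_pow (Real.sqrt_nonneg _), Real.sq_sqrt (le_of_lt μ.2)]

theorem KernelMetric.isCompactOperator_of_schattenNorm_le {p lam : ℝ} {T : H →L[ℝ] H}
    (h : KernelMetric.schattenNorm p T ≤ ENNReal.ofReal lam) : IsCompactOperator T := by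
  by_contra hT
  rw [schattenNorm, if_neg hT, top_le_iff] at h
  exact ENNReal.ofReal_ne_top h

theorem KernelMetric.tsum_ofReal_norm_sq_le (b : HilbertBasis ι ℝ H) {lam : ℝ} (hlam : 0 ≤ lam)
    {T : H →L[ℝ] H} (h : KernelMetric.schattenNorm 2 T ≤ ENNReal.ofReal lam) :
    ∑' i, ENNReal.ofReal (‖T (b i)‖ ^ 2) ≤ ENNReal.ofReal (lam ^ 2) := by
  rw [schattenNorm_two_eq b (isCompactOperator_of_schattenNorm_le h)] at h
  have := ENNReal.rpow_le_rpow h (z := 2) (by norm_num)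
  rwa [← ENNReal.rpow_mul, one_div, inv_mul_cancel₀ two_ne_zero, ENNReal.rpow_one,
    ENNReal.rpow_two, ← ENNReal.ofReal_pow hlam] at this

/-- The left factor `P†` shrinks each basis image. The right factor becomes a left factor after
passing to adjoints, which preserves the Hilbert–Schmidt sum. -/
theorem KernelMetric.schattenNorm_two_conj_le {lam : ℝ} {T P : H →L[ℝ] H} (hP : ‖P‖ ≤ 1)
    (h : KernelMetric.schattenNorm 2 T ≤ ENNReal.ofReal lam) :
    KernelMetric.schattenNorm 2 (P† ∘L T ∘L P) ≤ ENNReal.ofReal lam := by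
  obtain ⟨s, b, -⟩ := exists_hilbertBasis ℝ H
  have hT := isCompactOperator_of_schattenNorm_le h
  refine le_trans ?_ h
  rw [schattenNorm_two_eq b hT, schattenNorm_two_eq b ((hT.comp_clm P).clm_comp (P†))]
  refine ENNReal.rpow_le_rpow ?_ (by norm_num)
  have hle : ∀ x, ‖(P†) x‖ ≤ ‖x‖ := fun x => by
    refine ((P†).le_opNorm x).trans (mul_le_of_le_one_left (norm_nonneg _) ?_)
    rwa [LinearIsometryEquiv.norm_map]
  calc ∑' i, ENNReal.ofReal (‖(P† ∘L T ∘L P) (b i)‖ ^ 2)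
      ≤ ∑' i, ENNReal.ofReal (‖(T ∘L P) (b i)‖ ^ 2) :=
        ENNReal.tsum_le_tsum fun i => ENNReal.ofReal_le_ofReal
          (pow_le_pow_left₀ (norm_nonneg _) (hle _) 2)
    _ = ∑' i, ENNReal.ofReal (‖((T ∘L P)†) (b i)‖ ^ 2) :=
        (b.tsum_ofReal_norm_sq_adjoint _).symm
    _ ≤ ∑' i, ENNReal.ofReal (‖(T†) (b i)‖ ^ 2) :=
        ENNReal.tsum_le_tsum fun i => ENNReal.ofReal_le_ofReal <| by
          rw [ContinuousLinearMap.adjoint_comp]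
          exact pow_le_pow_left₀ (norm_nonneg _) (hle _) 2
    _ = _ := b.tsum_ofReal_norm_sq_adjoint T

end HilbertSchmidt

/-! ### Elementary tensors -/

section Tensor

variable {H : Type*} [NormedAddCommGroup H] [InnerProductSpace ℝ H] {ι : Type*}

theorem HilbertBasis.hasSum_inner_smul_smul (b : HilbertBasis ι ℝ H) (x x' y y' : H) :
    HasSum (fun i => ⟪⟪b i, x⟫_ℝ • y, ⟪b i, x'⟫_ℝ • y'⟫_ℝ) (⟪x, x'⟫_ℝ * ⟪y, y'⟫_ℝ) := by
  have h := (b.hasSum_inner_mul_inner x x').mul_right ⟪y, y'⟫_ℝ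
  have heq : ∀ i, ⟪⟪b i, x⟫_ℝ • y, ⟪b i, x'⟫_ℝ • y'⟫_ℝ =
      ⟪x, b i⟫_ℝ * ⟪b i, x'⟫_ℝ * ⟪y, y'⟫_ℝ := fun i => by
    rw [real_inner_smul_left, real_inner_smul_right, real_inner_comm x, mul_assoc]
  simpa only [heq] using h

theorem memlp_two_of_summable {E : ι → Type*} [∀ i, NormedAddCommGroup (E i)] {f : ∀ i, E i}
    (h : Summable fun i => ‖f i‖ ^ 2) : Memℓp f 2 :=
  memℓp_gen (by simpa using h)

/-- The elementary tensor `x ⊗ y`, as the family of the values at a Hilbert basis of the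
Hilbert–Schmidt operator `e ↦ ⟪e, x⟫ y`. -/
noncomputable def HilbertBasis.tensor (b : HilbertBasis ι ℝ H) (x y : H) : lp (fun _ : ι => H) 2 :=
  ⟨fun i => ⟪b i, x⟫_ℝ • y, memlp_two_of_summable (by
    simpa only [real_inner_self_eq_norm_sq] using (b.hasSum_inner_smul_smul x x y y).summable)⟩

theorem HilbertBasis.inner_tensor_tensor (b : HilbertBasis ι ℝ H) (x y x' y' : H) :
    ⟪b.tensor x y, b.tensor x' y'⟫_ℝ = ⟪x, x'⟫_ℝ * ⟪y, y'⟫_ℝ :=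
  (lp.hasSum_inner _ _).unique (b.hasSum_inner_smul_smul x x' y y')

theorem HilbertBasis.norm_tensor (b : HilbertBasis ι ℝ H) (x y : H) :
    ‖b.tensor x y‖ = ‖x‖ * ‖y‖ := by
  rw [← sq_eq_sq₀ (norm_nonneg _) (by positivity), ← real_inner_self_eq_norm_sq,
    b.inner_tensor_tensor, real_inner_self_eq_norm_sq, real_inner_self_eq_norm_sq, mul_pow]

theorem HilbertBasis.continuous_tensor (b : HilbertBasis ι ℝ H) :
    Continuous fun p : H × H => b.tensor p.1 p.2 :=
  ((LinearMap.mk₂ ℝ b.tensor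
    (fun x x' y => by ext i; simp [HilbertBasis.tensor, inner_add_right, add_smul]; rfl)
    (fun c x y => by ext i; simp [HilbertBasis.tensor, inner_smul_right, mul_smul])
    (fun x y y' => by ext i; simp [HilbertBasis.tensor]; rfl)
    (fun c x y => by ext i; simp [HilbertBasis.tensor, smul_comm c])).mkContinuous₂ 1
      fun x y => by simp [b.norm_tensor]).continuous₂

/-- The space `lp (fun _ => H) 2` stands for the Hilbert–Schmidt operators, `T` being encoded by its
values `T (b i)`. Pairing with a tensor is then Parseval for `x` and `T† y`. -/
theorem KernelMetric.exists_inner_tensor_eq [CompleteSpace H] (b : HilbertBasis ι ℝ H) {lam : ℝ}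
    (hlam : 0 ≤ lam) {T : H →L[ℝ] H} (h : KernelMetric.schattenNorm 2 T ≤ ENNReal.ofReal lam) :
    ∃ w : lp (fun _ : ι => H) 2, ‖w‖ ≤ lam ∧ ∀ x y, ⟪w, b.tensor x y⟫_ℝ = ⟪T x, y⟫_ℝ := by
  have hle := tsum_ofReal_norm_sq_le b hlam h
  have hs : Summable fun i => ‖T (b i)‖ ^ 2 := by
    have := ENNReal.summable_toReal (ne_top_of_le_ne_top ENNReal.ofReal_ne_top hle)
    simpa [ENNReal.toReal_ofReal] using this
  refine ⟨⟨fun i => T (b i), memlp_two_of_summable hs⟩, ?_, fun x y => ?_⟩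
  · rw [← sq_le_sq₀ (norm_nonneg _) hlam, ← real_inner_self_eq_norm_sq, lp.inner_eq_tsum]
    simp only [real_inner_self_eq_norm_sq]
    rwa [← ENNReal.ofReal_le_ofReal_iff (sq_nonneg lam),
      ENNReal.ofReal_tsum_of_nonneg (fun i => sq_nonneg _) hs]
  · refine (lp.hasSum_inner _ _).unique ?_
    rw [← ContinuousLinearMap.adjoint_inner_right]
    have h1 := b.hasSum_inner_mul_inner x ((T†) y)
    have heq : ∀ i, ⟪T (b i), ⟪b i, x⟫_ℝ • y⟫_ℝ = ⟪x, b i⟫_ℝ * ⟪b i, (T†) y⟫_ℝ := fun i => by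
      rw [real_inner_smul_right, ContinuousLinearMap.adjoint_inner_right, real_inner_comm x]
    simpa only [HilbertBasis.tensor, heq] using h1

end Tensor

/-! ### Triplet features -/

section TripletFeature

variable {H : Type*} [NormedAddCommGroup H] [InnerProductSpace ℝ H] {ι : Type*}

/-- Let `p`, `q`, `r` be the squared distances. By the law of cosines the left side is `(p - q)² / 2
+ r (p + q) - r² / 2`. As `|p - q| ≤ 4 B²` and `p + q + r ≤ 9 B²` (from `‖a + b + c‖² ≥ 0`), it is
at most `21.5 B⁴ - 1.5 (r - 3 B²)²`. The constant 24 is the square of `2√6`. -/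
theorem norm_sq_sub_add_le {a b c : H} {B : ℝ} (ha : ‖a‖ ≤ B) (hb : ‖b‖ ≤ B) (hc : ‖c‖ ≤ B) :
    (‖a - b‖ ^ 2) ^ 2 + (‖a - c‖ ^ 2) ^ 2 - 2 * ⟪a - b, a - c⟫_ℝ ^ 2 ≤ 24 * B ^ 4 := by
  have hsq : ∀ x : H, ‖x‖ ≤ B → ‖x‖ ^ 2 ≤ B ^ 2 := fun x hx =>
    pow_le_pow_left₀ (norm_nonneg _) hx 2
  have hd : ∀ x y : H, ‖x‖ ≤ B → ‖y‖ ≤ B → ‖x - y‖ ^ 2 ≤ 4 * B ^ 2 := fun x y hx hy => by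
    nlinarith [parallelogram_law_with_norm ℝ x y, hsq x hx, hsq y hy, norm_nonneg (x + y),
      sq_nonneg ‖x + y‖]
  have hp := hd a b ha hb
  have hq := hd a c ha hc
  have hr : ⟪a - b, a - c⟫_ℝ = (‖a - b‖ ^ 2 + ‖a - c‖ ^ 2 - ‖b - c‖ ^ 2) / 2 := by
    have h := norm_sub_sq_real (a - c) (a - b)
    rw [sub_sub_sub_cancel_left, real_inner_comm] at h
    linarith
  have hsum : ‖a - b‖ ^ 2 + ‖a - c‖ ^ 2 + ‖b - c‖ ^ 2 ≤ 9 * B ^ 2 := by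
    have h0 : 0 ≤ ‖a + b + c‖ ^ 2 := sq_nonneg _
    rw [norm_add_sq_real, norm_add_sq_real, inner_add_left] at h0
    rw [norm_sub_sq_real, norm_sub_sq_real, norm_sub_sq_real]
    linarith [hsq a ha, hsq b hb, hsq c hc]
  rw [hr]
  set p := ‖a - b‖ ^ 2 with hp'
  set q := ‖a - c‖ ^ 2 with hq'
  set r := ‖b - c‖ ^ 2 with hr'
  have p0 : 0 ≤ p := sq_nonneg _
  have q0 : 0 ≤ q := sq_nonneg _
  have r0 : 0 ≤ r := sq_nonneg _
  have h1 : (p - q) ^ 2 ≤ (4 * B ^ 2) ^ 2 := sq_le_sq' (by linarith) (by linarith)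
  have h2 : r * (p + q) ≤ r * (9 * B ^ 2 - r) := mul_le_mul_of_nonneg_left (by linarith) r0
  nlinarith [sq_nonneg (r - 3 * B ^ 2), sq_nonneg (B ^ 2)]

open Classical in
/-- The Hilbert–Schmidt representer of `L† L ↦ y * distDiff φ L t`, for a label `y ∈ {1, -1}`. -/
noncomputable def KernelMetric.tripletFeature {d : ℕ} (b : HilbertBasis ι ℝ H) (φ : KernelMetric.Point d → H)
    (z : KernelMetric.LabelledTriplet d) : lp (fun _ : ι => H) 2 :=
  -- Using a sign instead of the label makes the norm bound hold at every `z`, not only almost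
  -- everywhere.
  (if z.2 = 1 then (1 : ℝ) else -1) •
    (b.tensor (φ z.1.1 - φ z.1.2.1) (φ z.1.1 - φ z.1.2.1) -
      b.tensor (φ z.1.1 - φ z.1.2.2) (φ z.1.1 - φ z.1.2.2))

theorem KernelMetric.stronglyMeasurable_tripletFeature {d : ℕ} (b : HilbertBasis ι ℝ H)
    {φ : KernelMetric.Point d → H} (hφ : StronglyMeasurable φ) :
    StronglyMeasurable (KernelMetric.tripletFeature b φ) := by
  have hc : Continuous fun x : H => b.tensor x x :=
    b.continuous_tensor.comp (continuous_id.prodMk continuous_id)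
  have h1 : StronglyMeasurable fun z : KernelMetric.LabelledTriplet d => φ z.1.1 :=
    hφ.comp_measurable (by fun_prop)
  have h2 : StronglyMeasurable fun z : KernelMetric.LabelledTriplet d => φ z.1.2.1 :=
    hφ.comp_measurable (by fun_prop)
  have h3 : StronglyMeasurable fun z : KernelMetric.LabelledTriplet d => φ z.1.2.2 :=
    hφ.comp_measurable (by fun_prop)
  have h4 : StronglyMeasurable fun z : KernelMetric.LabelledTriplet d =>
      if z.2 = 1 then (1 : ℝ) else -1 :=
    StronglyMeasurable.ite (measurableSet_eq_fun measurable_snd measurable_const)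
      stronglyMeasurable_const stronglyMeasurable_const
  exact h4.smul ((hc.comp_stronglyMeasurable (h1.sub h2)).sub
    (hc.comp_stronglyMeasurable (h1.sub h3)))

theorem KernelMetric.norm_tripletFeature_le {d : ℕ} (b : HilbertBasis ι ℝ H)
    {φ : KernelMetric.Point d → H} {B : ℝ} (hB : ∀ x, ‖φ x‖ ≤ B)
    (z : KernelMetric.LabelledTriplet d) :
    ‖KernelMetric.tripletFeature b φ z‖ ≤ 2 * √6 * B ^ 2 := by
  have h1 : ‖(if z.2 = 1 then (1 : ℝ) else -1)‖ = 1 := by split_ifs <;> simp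
  rw [tripletFeature, norm_smul, h1, one_mul, ← sq_le_sq₀ (norm_nonneg _) (by positivity),
    norm_sub_sq_real, b.inner_tensor_tensor, b.norm_tensor, b.norm_tensor, mul_pow (2 * √6),
    mul_pow 2, Real.sq_sqrt (by norm_num)]
  have := norm_sq_sub_add_le (hB z.1.1) (hB z.1.2.1) (hB z.1.2.2)
  nlinarith

theorem KernelMetric.inner_tripletFeature {d : ℕ} [CompleteSpace H] (b : HilbertBasis ι ℝ H)
    (φ : KernelMetric.Point d → H) {L : H →L[ℝ] H} {w : lp (fun _ : ι => H) 2}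
    (hw : ∀ x y, ⟪w, b.tensor x y⟫_ℝ = ⟪(L† ∘L L) x, y⟫_ℝ)
    {z : KernelMetric.LabelledTriplet d} (hz : z.2 = 1 ∨ z.2 = -1) :
    ⟪w, KernelMetric.tripletFeature b φ z⟫_ℝ = z.2 * KernelMetric.distDiff φ L z.1 := by
  have hlab : (if z.2 = 1 then (1 : ℝ) else -1) = z.2 := by
    rcases hz with h | h <;> rw [h] <;> norm_num
  have hn : ∀ x, ⟪(L† ∘L L) x, x⟫_ℝ = ‖L x‖ ^ 2 := fun x => by
    rw [ContinuousLinearMap.comp_apply, ContinuousLinearMap.adjoint_inner_left,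
      real_inner_self_eq_norm_sq]
  rw [tripletFeature, hlab, inner_smul_right, inner_sub_right, hw, hw, hn, hn, distDiff, map_sub,
    map_sub]

end TripletFeature

/-! ### Feasibility of the two minimizers, and the main theorem -/

namespace KernelMetric

variable {d m : ℕ} {H : Type*} [NormedAddCommGroup H] [InnerProductSpace ℝ H] [CompleteSpace H]

theorem IsSpanRestrictedERM.schattenNorm_le {φ : Point d → H} {ℓ : ℝ → ℝ}
    {S : Fin m → LabelledTriplet d} {lam : ℝ} {L₀ : H →L[ℝ] H}
    (h : IsSpanRestrictedERM φ ℓ S lam L₀) :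
    schattenNorm 2 (L₀† ∘L L₀) ≤ ENNReal.ofReal lam := by
  obtain ⟨h1, -, h3⟩ := h
  have h4 : (sampleProj φ S)† ∘L L₀† = L₀† := by
    rw [← ContinuousLinearMap.adjoint_comp, h3]
  have h5 : (sampleProj φ S)† ∘L L₀† ∘L L₀ ∘L sampleProj φ S = L₀† ∘L L₀ := by
    rw [h3, ← ContinuousLinearMap.comp_assoc, h4]
  rw [← h5]
  exact h1

/-- This lets `L*` compete in the empirical problem, whatever the sample. -/
theorem mem_spanFeasible {φ : Point d → H} (S : Fin m → LabelledTriplet d) {lam : ℝ}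
    {L : H →L[ℝ] H} (h : schattenNorm 2 (L† ∘L L) ≤ ENNReal.ofReal lam) :
    L ∈ spanFeasible φ S lam := by
  have hP : ‖sampleProj φ S‖ ≤ 1 := (sampleSpan φ S).starProjection_norm_le
  have := schattenNorm_two_conj_le hP h
  rwa [ContinuousLinearMap.comp_assoc] at this

end KernelMetric

theorem theorem1 {d : ℕ} {H : Type*} [NormedAddCommGroup H] [InnerProductSpace ℝ H]
    [CompleteSpace H]
    (k : KernelMetric.Point d → KernelMetric.Point d → ℝ)
    (φ : KernelMetric.Point d → H) (hφ : StronglyMeasurable φ)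
    (hk : KernelMetric.IsFeatureMap k φ)
    (B : ℝ) (hB : ∀ x, ‖φ x‖ ≤ B)
    (ℓ : ℝ → ℝ) (α : ℝ≥0) (hℓ : LipschitzWith α ℓ)
    (δ lamF : ℝ) (hδ : 0 < δ) (hlam : 0 < lamF)
    -- the joint law of a random triplet and its label
    (μ : Measure (KernelMetric.LabelledTriplet d)) [IsProbabilityMeasure μ]
    (hlabel : ∀ᵐ z ∂μ, z.2 = 1 ∨ z.2 = -1)
    (Lstar : H →L[ℝ] H) (hLstar : KernelMetric.IsTrueRiskMinimizer φ ℓ μ lamF Lstar)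
    -- the number of triplets in the i.i.d. sample
    (m : ℕ) (hm : 0 < m) :
    ∃ E : Set (Fin m → KernelMetric.LabelledTriplet d), MeasurableSet E ∧
      ENNReal.ofReal (1 - δ) ≤ Measure.pi (fun _ : Fin m => μ) E ∧
      ∀ S ∈ E, ∀ L₀ : H →L[ℝ] H, KernelMetric.IsSpanRestrictedERM φ ℓ S lamF L₀ →
        KernelMetric.trueRisk φ ℓ μ L₀ - KernelMetric.trueRisk φ ℓ μ Lstar ≤
          4 * α * B ^ 2 * lamF * Real.sqrt (6 / m)
            + 12 * α * B ^ 2 * lamF * Real.sqrt (2 * Real.log (2 / δ) / m) := by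
  -- For `δ > 1` the required probability is nonpositive, so the empty event suffices.
  by_cases hδ1 : 1 < δ
  · refine ⟨∅, MeasurableSet.empty, ?_, fun S hS => hS.elim⟩
    rw [ENNReal.ofReal_of_nonpos (by linarith)]
    exact zero_le
  rw [not_lt] at hδ1
  obtain ⟨ι, b, -⟩ := exists_hilbertBasis ℝ H
  have hm' : (0 : ℝ) < m := Nat.cast_pos.2 hm
  have hα : (0 : ℝ) ≤ α := α.2
  obtain ⟨v, hv, hv'⟩ := KernelMetric.exists_inner_tensor_eq b hlam.le hLstar.1
  obtain ⟨E, hE, hEμ, hbound⟩ := exists_uniform_risk_bound_of_complete μ hℓ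
    (KernelMetric.stronglyMeasurable_tripletFeature b hφ)
    (KernelMetric.norm_tripletFeature_le b hB) hv hm hδ hδ1
  -- The empirical risk is evaluated at individual sample points, so the event must also force every
  -- label to be `1` or `-1`; this costs no probability.
  set A : Set (Fin m → KernelMetric.LabelledTriplet d) :=
    Set.univ.pi fun _ => Prod.snd ⁻¹' {1, -1} with hA
  have hAm : MeasurableSet A :=
    MeasurableSet.univ_pi fun _ => measurable_snd ((Set.toFinite _).measurableSet)
  have hAae : ∀ᵐ S ∂Measure.pi (fun _ : Fin m => μ), S ∈ A := by
    have h : ∀ᵐ S ∂Measure.pi (fun _ : Fin m => μ), ∀ s, (S s).2 = 1 ∨ (S s).2 = -1 :=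
      ae_all_iff.2 fun s =>
        (measurePreserving_eval (fun _ : Fin m => μ) s).quasiMeasurePreserving.ae hlabel
    filter_upwards [h] with S hS s _ using hS s
  refine ⟨E ∩ A, hE.inter hAm, ?_, fun S hS L₀ hL₀ => ?_⟩
  · have hEA : Measure.pi (fun _ : Fin m => μ) (E ∩ A) = Measure.pi (fun _ : Fin m => μ) E :=
      measure_inter_conull hAae
    rwa [hEA]
  have hlab : ∀ s, (S s).2 = 1 ∨ (S s).2 = -1 := fun s => hS.2 s (Set.mem_univ s)
  obtain ⟨w, hw, hw'⟩ := KernelMetric.exists_inner_tensor_eq b hlam.le hL₀.schattenNorm_le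
  have hrisk : ∀ {L : H →L[ℝ] H} {w : lp (fun _ : ι => H) 2},
      (∀ x y, ⟪w, b.tensor x y⟫_ℝ = ⟪(L† ∘L L) x, y⟫_ℝ) →
      KernelMetric.trueRisk φ ℓ μ L = (∫ z, ℓ ⟪w, KernelMetric.tripletFeature b φ z⟫_ℝ ∂μ) ∧
      KernelMetric.empiricalRisk φ ℓ S L =
        1 / (m : ℝ) * ∑ s, ℓ ⟪w, KernelMetric.tripletFeature b φ (S s)⟫_ℝ := fun hw => by
    refine ⟨integral_congr_ae ?_, ?_⟩
    · filter_upwards [hlabel] with z hz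
      rw [KernelMetric.inner_tripletFeature b φ hw hz]
    · simp only [KernelMetric.empiricalRisk, KernelMetric.inner_tripletFeature b φ hw (hlab _)]
  have hERM : KernelMetric.empiricalRisk φ ℓ S L₀ ≤ KernelMetric.empiricalRisk φ ℓ S Lstar :=
    hL₀.2.1 (KernelMetric.mem_spanFeasible S hLstar.1)
  have h := hbound S hS.1 w hw
  rw [← (hrisk hw').1, ← (hrisk hw').2, ← (hrisk hv').1, ← (hrisk hv').2] at h
  have hfirst : 2 * (α * lamF * (2 * √6 * B ^ 2)) / √m =
      4 * α * B ^ 2 * lamF * √(6 / m) := by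
    rw [Real.sqrt_div (by norm_num)]
    ring
  -- The argument gives the constant `4√6` and `log (1 / δ)`; they are relaxed to 12 and `log (2 /
  -- δ)`.
  have hsix : √6 ≤ 3 := by
    rw [Real.sqrt_le_left (by norm_num)]
    norm_num
  have hlog : √(2 * Real.log (1 / δ) / m) ≤ √(2 * Real.log (2 / δ) / m) := by
    have : Real.log (1 / δ) ≤ Real.log (2 / δ) :=
      Real.log_le_log (by positivity) (by gcongr; norm_num)
    gcongr
  have hsecond : 2 * (α * lamF * (2 * √6 * B ^ 2)) * √(2 * Real.log (1 / δ) / m) ≤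
      12 * α * B ^ 2 * lamF * √(2 * Real.log (2 / δ) / m) := by
    refine mul_le_mul ?_ hlog (Real.sqrt_nonneg _) (by positivity)
    have := mul_le_mul_of_nonneg_left hsix (by positivity : 0 ≤ 4 * α * B ^ 2 * lamF)
    linarith
  linarith
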